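/- Let $F$ be a free group of rank two with free basis $A=\{a,b\}$. An element $g$ of a group $G$ is a \emph{test element} if every endomorphism of $G$ fixing $g$ is an automorphism of $G$, and a \emph{proper power} if $g=u^n$ for some $u\in G$ and some integer $n\ge 2$. For $w\in F$ let $w_a,w_b\in\mathbb Z$ be the exponent sums on $a$ and on $b$ in the freely reduced word over $A$ representing $w$, and let $\overline w=(w_a,w_b)\in\mathbb Z^2$ be the image of $w$ in the abelianization of $F$, identified with $\mathbb Z^2$ via $\overline a=(1,0)$, $\overline b=(0,1)$. Call $w$ \emph{visible} if $\overline w\neq 0$ and $\gcd(w_a,w_b)=1$. Let $w\in F$ be a nontrivial element that is not a proper power in $F$. Then $w$ is a test element in $F$ if and only if there exists an integer $n\ge 2$ such that $\overline w$ is an $n$-th power in $\mathbb Z^2$ (that is, $\overline w=n z$ for some $z\in\mathbb Z^2$); equivalently, if and only if $\gcd(w_a,w_b)\ge 2$, with the convention $\gcd(0,0)=\infty$. That is, $w$ is not a test element in $F$ if and only if $w$ is visible in $F$. -/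

import Mathlib

/-- An element `g` of a group `G` is a test element if every endomorphism of `G` fixing `g`
is an automorphism of `G`. -/
def IsTestElement {G : Type*} [Group G] (g : G) : Prop :=
  ∀ φ : G →* G, φ g = g → Function.Bijective φ

/-- `g` is an `n`-th power in the group `G`. -/
def IsNthPower {G : Type*} [Group G] (n : ℕ) (g : G) : Prop :=
  ∃ u : G, g = u ^ n

/-- `g` is a proper power in `G`: an `n`-th power for some `n ≥ 2`. -/
def IsProperPower {G : Type*} [Group G] (g : G) : Prop :=
  ∃ n : ℕ, 2 ≤ n ∧ IsNthPower n g

/-- The abelianization homomorphism `F → ℤ^ι` of a free group `F` with free basis `A`,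
sending the `i`-th basis element to the `i`-th standard basis vector.  The additive group
`ℤ^ι` is written multiplicatively. -/
noncomputable def abelianizationMap {ι F : Type*} [DecidableEq ι] [Group F]
    (A : FreeGroupBasis ι F) : F →* Multiplicative (ι → ℤ) :=
  A.lift (fun i => Multiplicative.ofAdd (Pi.single i (1 : ℤ)))

/-- The exponent sum on the basis element `A i` in `w`, computed from the freely reduced word
in `A` that represents `w` (a letter `(i, true)` stands for `A i`, and `(i, false)` for its
inverse). -/
noncomputable def exponentSum {ι F : Type*} [DecidableEq ι] [Group F]
    (A : FreeGroupBasis ι F) (i : ι) (w : F) : ℤ :=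
  ((A.repr w).toWord.map
    (fun p : ι × Bool => if p.1 = i then (if p.2 then (1 : ℤ) else -1) else 0)).sum

/-- A point of `ℤ^ι` is visible if it is nonzero and the greatest common divisor of its
coordinates is `1`. -/
def IsVisiblePoint {ι : Type*} [Fintype ι] (z : ι → ℤ) : Prop :=
  z ≠ 0 ∧ Finset.univ.gcd z = 1

/-- An element of a free group is visible if its image in the abelianization `ℤ^ι` is. -/
def IsVisibleElement {ι F : Type*} [Fintype ι] [DecidableEq ι] [Group F]
    (A : FreeGroupBasis ι F) (w : F) : Prop :=
  IsVisiblePoint (Multiplicative.toAdd (abelianizationMap A w))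

/-- The greatest common divisor of two integers, with the convention `gcd (0, 0) = ∞`. -/
noncomputable def gcdTop (x y : ℤ) : ℕ∞ :=
  if x = 0 ∧ y = 0 then ⊤ else (Int.gcd x y : ℕ∞)

/-- The coordinates of the image of `w` in the abelianization are the exponent sums of `w`. -/
theorem abelianizationMap_apply {ι F : Type*} [DecidableEq ι] [Group F]
    (A : FreeGroupBasis ι F) (w : F) (i : ι) :
    Multiplicative.toAdd (abelianizationMap A w) i = exponentSum A i w := by
  have h1 : abelianizationMap A w =
      FreeGroup.lift (fun i => Multiplicative.ofAdd (Pi.single i (1 : ℤ))) (A.repr w) := rfl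
  rw [h1, exponentSum]
  conv_lhs => rw [← FreeGroup.mk_toWord (x := A.repr w)]
  rw [FreeGroup.lift_mk]
  generalize (A.repr w).toWord = L
  induction L with
  | nil => rfl
  | cons p L ih =>
    obtain ⟨j, b⟩ := p
    simp only [List.map_cons, List.prod_cons, List.sum_cons, toAdd_mul, Pi.add_apply, ih]
    congr 1
    rcases eq_or_ne j i with rfl | h
    · cases b <;> simp
    · cases b <;> simp [h, h.symm]

/-!
Write `a, b` for the basis and `w_a, w_b` for the exponent sums of `w`. Each condition on the
abelianization says that `w_a` and `w_b` are, or are not, coprime, so the point is that `w` fails to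
be a test element exactly when they are coprime.

If `x * w_a + y * w_b = 1`, then `a ↦ w ^ x`, `b ↦ w ^ y` is an endomorphism with commutative image
that fixes `w` (`not_isTestElement_of_isCoprime`).

Conversely, suppose first that some endomorphism that is not injective fixes `w`. Its image is free
by the Nielsen–Schreier theorem, and the Hopf property forces it to be cyclic
(`FreeGroup.isCyclic_range_of_not_injective`). So `w` is a power of a generator `u` of the image,
and since `w` is not a proper power, `w = u ^ (±1)`; reading off exponents gives coprimality
(`isCoprime_of_isCyclic_range`).

It remains to see that if `w` is fixed by an injective endomorphism `φ` that is not surjective, then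
it is also fixed by one that is not injective
(`FreeGroup.exists_not_injective_of_not_bijective`). Let `H n` be the image of `φ ^ n`, a strictly
descending chain of subgroups isomorphic to `F`, all containing `w`. In the Schreier graph of `H n`,
the loops at the base point that stay in the full subgraph on the vertices visited by `w` form a
subgroup `K n`. It is a retract of `H n` that contains `w`, and it is generated by elements
`p⁻¹ * g * q` with `g` a basis element and `p`, `q` suffixes of the word `w`, so only finitely many
subgroups occur as `K n` (`FreeGroup.exists_retraction_onto_loopSubgroup`). Hence `K n ≠ H n` for
some `n`, and the retraction `H n → K n`, transported to `F` by `φ ^ n`, fixes `w` and is not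
injective.
-/

/-! ### Suffixes of a reduced word -/

namespace FreeGroup

variable {ι : Type*} [DecidableEq ι]

/-- The elements of a free group represented by a suffix of the reduced word of `w`. -/
def suffixes (w : FreeGroup ι) : Set (FreeGroup ι) :=
  {s | ∃ L, L <:+ w.toWord ∧ FreeGroup.mk L = s}

theorem finite_suffixes (w : FreeGroup ι) : (suffixes w).Finite := by
  refine ((List.finite_toSet w.toWord.tails).image FreeGroup.mk).subset ?_
  rintro s ⟨L, hL, rfl⟩
  exact ⟨L, by simpa using hL, rfl⟩

theorem one_mem_suffixes (w : FreeGroup ι) : 1 ∈ suffixes w :=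
  ⟨[], List.nil_suffix, rfl⟩

theorem self_mem_suffixes (w : FreeGroup ι) : w ∈ suffixes w :=
  ⟨w.toWord, List.suffix_rfl, mk_toWord⟩

/-- Induction along the word `w`, read from its end, one letter at a time. -/
@[elab_as_elim]
theorem suffixes_induction {w : FreeGroup ι} {P : FreeGroup ι → Prop} (one : P 1)
    (of_mul : ∀ i s, s ∈ suffixes w → of i * s ∈ suffixes w → P s → P (of i * s))
    (inv_mul : ∀ i s, s ∈ suffixes w → (of i)⁻¹ * s ∈ suffixes w → P s → P ((of i)⁻¹ * s))
    {s : FreeGroup ι} (hs : s ∈ suffixes w) : P s := by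
  obtain ⟨L, hL, rfl⟩ := hs
  induction L with
  | nil => exact one
  | cons p L ih =>
    have hL' : L <:+ w.toWord := (List.suffix_cons p L).trans hL
    obtain ⟨i, b⟩ := p
    cases b with
    | true =>
      have h : FreeGroup.mk ((i, true) :: L) = of i * FreeGroup.mk L := rfl
      rw [h]
      exact of_mul i _ ⟨L, hL', rfl⟩ ⟨_, hL, h⟩ (ih hL')
    | false =>
      have h : FreeGroup.mk ((i, false) :: L) = (of i)⁻¹ * FreeGroup.mk L := rfl
      rw [h]
      exact inv_mul i _ ⟨L, hL', rfl⟩ ⟨_, hL, h⟩ (ih hL')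

/-! ### Residual finiteness and the Hopf property -/

/-- Free groups are residually finite: each generator permutes the finite set of suffixes of `w`,
by left multiplication wherever this stays inside the set, so that `w` moves `1` to `w`. -/
theorem exists_finite_quotient_apply_ne_one {ι : Type*} {w : FreeGroup ι} (hw : w ≠ 1) :
    ∃ (n : ℕ) (ρ : FreeGroup ι →* Equiv.Perm (Fin n)), ρ w ≠ 1 := by
  classical
  have := (finite_suffixes w).to_subtype
  let e (i : ι) : {s : suffixes w // of i * (s : FreeGroup ι) ∈ suffixes w} ≃
      {s : suffixes w // (of i)⁻¹ * (s : FreeGroup ι) ∈ suffixes w} :=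
    { toFun := fun s => ⟨⟨of i * s.1, s.2⟩, by simp⟩
      invFun := fun s => ⟨⟨(of i)⁻¹ * s.1, s.2⟩, by simp⟩
      left_inv := fun s => by simp
      right_inv := fun s => by simp }
  let ρ : FreeGroup ι →* Equiv.Perm (suffixes w) := lift fun i => (e i).extendSubtype
  have hρ (i : ι) (s : suffixes w) (h : of i * (s : FreeGroup ι) ∈ suffixes w) :
      ρ (of i) s = ⟨of i * s, h⟩ := by
    simp only [ρ, lift_apply_of]
    exact (e i).extendSubtype_apply_of_mem s h
  have key : ∀ {s}, s ∈ suffixes w → (ρ s ⟨1, one_mem_suffixes w⟩ : FreeGroup ι) = s := by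
    intro s hs
    refine suffixes_induction ?_ ?_ ?_ hs
    · simp
    · intro i s hs h ih
      have ih' : ρ s ⟨1, one_mem_suffixes w⟩ = ⟨s, hs⟩ := Subtype.ext ih
      rw [_root_.map_mul, Equiv.Perm.mul_apply, ih', hρ i ⟨s, hs⟩ h]
    · intro i s hs h ih
      have ih' : ρ s ⟨1, one_mem_suffixes w⟩ = ⟨s, hs⟩ := Subtype.ext ih
      have h2 : ρ (of i) ⟨(of i)⁻¹ * s, h⟩ = ⟨s, hs⟩ := by
        rw [hρ i ⟨(of i)⁻¹ * s, h⟩ (by simpa using hs)]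
        simp
      rw [_root_.map_mul, _root_.map_inv, Equiv.Perm.mul_apply, ih', ← h2]
      simp
  let c := (Finite.equivFin (suffixes w)).permCongrHom
  refine ⟨_, c.toMonoidHom.comp ρ, fun h => hw ?_⟩
  have h1 : ρ w = 1 := by
    apply c.injective
    rw [_root_.map_one]
    exact h
  have := key (self_mem_suffixes w)
  rw [h1] at this
  simpa using this.symm

/-- A free group of finite rank is Hopfian: precomposition with a surjective endomorphism is
injective, hence surjective, on the finite set of homomorphisms to a given finite group. -/
theorem injective_of_surjective {ι : Type*} [Finite ι] (f : FreeGroup ι →* FreeGroup ι)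
    (hf : Function.Surjective f) : Function.Injective f := by
  rw [injective_iff_map_eq_one]
  intro w hw
  by_contra h
  obtain ⟨n, ρ, hρ⟩ := exists_finite_quotient_apply_ne_one h
  have hfin : Finite (FreeGroup ι →* Equiv.Perm (Fin n)) := Finite.of_equiv _ lift
  have hinj : Function.Injective
      (fun σ : FreeGroup ι →* Equiv.Perm (Fin n) => σ.comp f) := fun σ τ h =>
    MonoidHom.cancel_right hf |>.1 h
  obtain ⟨σ, hσ⟩ := Finite.surjective_of_injective hinj ρ
  apply hρ
  rw [← hσ]
  simp [hw]

theorem isCyclic_of_subsingleton (X : Type*) [Subsingleton X] : IsCyclic (FreeGroup X) := by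
  rcases isEmpty_or_nonempty X with hX | ⟨⟨x⟩⟩
  · exact _root_.isCyclic_of_subsingleton
  · refine ⟨of x, fun g => ?_⟩
    change g ∈ Subgroup.zpowers (of x)
    induction g using FreeGroup.induction_on with
    | C1 => exact Subgroup.one_mem _
    | of y => rw [Subsingleton.elim y x]; exact Subgroup.mem_zpowers _
    | inv_of y h => exact Subgroup.inv_mem _ h
    | mul g h hg hh => exact Subgroup.mul_mem _ hg hh

/-- By the Nielsen–Schreier theorem the image is free. If two of its basis elements were
distinct, it would map onto the free group of rank two, against the Hopf property. -/
theorem isCyclic_range_of_not_injective {G : Type*} [Group G] [IsFreeGroup G]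
    (f : FreeGroup (Fin 2) →* G) (hf : ¬ Function.Injective f) : IsCyclic f.range := by
  classical
  let X := IsFreeGroup.Generators f.range
  let e : f.range ≃* FreeGroup X := IsFreeGroup.toFreeGroup f.range
  by_cases hX : Subsingleton X
  · have := isCyclic_of_subsingleton X
    exact e.isCyclic.2 this
  · exfalso
    rw [not_subsingleton_iff_nontrivial] at hX
    obtain ⟨x, y, hxy⟩ := hX
    -- Mapping all other basis elements to that of index `1` as well keeps `g` surjective.
    let g : FreeGroup X →* FreeGroup (Fin 2) := lift fun z => if z = x then of 0 else of 1
    have hg : Function.Surjective g := by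
      let j : FreeGroup (Fin 2) →* FreeGroup X := lift ![of x, of y]
      have hgj : g.comp j = MonoidHom.id _ := by
        ext i
        fin_cases i <;> simp [g, j, hxy.symm]
      exact fun z => ⟨j z, DFunLike.congr_fun hgj z⟩
    have hs : Function.Surjective ((g.comp e.toMonoidHom).comp f.rangeRestrict) :=
      (hg.comp e.surjective).comp f.rangeRestrict_surjective
    have hi := injective_of_surjective _ hs
    apply hf
    intro a b hab
    apply hi
    have : f.rangeRestrict a = f.rangeRestrict b := Subtype.ext hab
    simp [this]

/-! ### Retractions from Schreier graphs -/

/-- The subgroups generated by elements `p⁻¹ * of i * q` with `p`, `q` suffixes of `w`. For every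
subgroup `H` containing `w`, they include the group of those loops of the Schreier graph of `H` that
stay among the vertices visited by `w`. The trivial element is admitted as a generator because it
serves as the label of edges outside that subgraph. -/
def loopSubgroups (w : FreeGroup ι) : Set (Subgroup (FreeGroup ι)) :=
  Subgroup.closure '' 𝒫 (insert 1
    {g | ∃ p ∈ suffixes w, ∃ q ∈ suffixes w, ∃ i, g = p⁻¹ * of i * q})

theorem finite_loopSubgroups [Finite ι] (w : FreeGroup ι) : (loopSubgroups w).Finite := by
  refine (Set.Finite.powerset (Set.Finite.insert _ ?_)).image _
  have h := ((finite_suffixes w).prod ((finite_suffixes w).prod (Set.finite_univ (α := ι)))).image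
    fun x => x.1⁻¹ * of x.2.2 * x.2.1
  refine h.subset ?_
  rintro g ⟨p, hp, q, hq, i, rfl⟩
  exact ⟨(p, q, i), ⟨hp, hq, trivial⟩, rfl⟩

section SchreierCocycle

variable {ι : Type*} {H : Subgroup (FreeGroup ι)}

/-- The permutation representation of the free group on `(F ⧸ H) × F` in which the generator `i`
sends `(v, x)` to `(of i • v, c i v * x)`: an arbitrary labelling `c` of the edges of the Schreier
graph of `H` extends to paths. -/
def cocycleAction (c : ι → FreeGroup ι ⧸ H → FreeGroup ι) :
    FreeGroup ι →* Equiv.Perm ((FreeGroup ι ⧸ H) × FreeGroup ι) :=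
  lift fun i =>
    { toFun := fun z => (of i • z.1, c i z.1 * z.2)
      invFun := fun z => ((of i)⁻¹ • z.1, (c i ((of i)⁻¹ • z.1))⁻¹ * z.2)
      left_inv := fun z => by simp
      right_inv := fun z => by simp }

variable (c : ι → FreeGroup ι ⧸ H → FreeGroup ι)

theorem cocycleAction_of (i : ι) (z : (FreeGroup ι ⧸ H) × FreeGroup ι) :
    cocycleAction c (of i) z = (of i • z.1, c i z.1 * z.2) := by
  simp [cocycleAction]

theorem cocycleAction_inv_of (i : ι) (z : (FreeGroup ι ⧸ H) × FreeGroup ι) :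
    cocycleAction c (of i)⁻¹ z = ((of i)⁻¹ • z.1, (c i ((of i)⁻¹ • z.1))⁻¹ * z.2) := by
  rw [_root_.map_inv, Equiv.Perm.inv_eq_iff_eq, cocycleAction_of]
  simp

theorem cocycleAction_fst (g : FreeGroup ι) (z : (FreeGroup ι ⧸ H) × FreeGroup ι) :
    (cocycleAction c g z).1 = g • z.1 := by
  induction g using FreeGroup.induction_on generalizing z with
  | C1 => simp
  | of i => rw [cocycleAction_of]
  | inv_of i _ => rw [cocycleAction_inv_of]
  | mul g h hg hh => rw [_root_.map_mul, Equiv.Perm.mul_apply, hg, hh, mul_smul]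

theorem cocycleAction_mul_right (g : FreeGroup ι) (v : FreeGroup ι ⧸ H) (x y : FreeGroup ι) :
    cocycleAction c g (v, x * y) = (g • v, (cocycleAction c g (v, x)).2 * y) := by
  induction g using FreeGroup.induction_on generalizing v x with
  | C1 => simp
  | of i => simp [cocycleAction_of, mul_assoc]
  | inv_of i _ => simp only [cocycleAction_inv_of, mul_assoc]
  | mul g h hg hh =>
    rw [_root_.map_mul, Equiv.Perm.mul_apply, hh, hg, mul_smul, Equiv.Perm.mul_apply,
      ← Prod.mk.eta (p := cocycleAction c h (v, x)), cocycleAction_fst]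

theorem cocycleAction_snd_mem {K : Subgroup (FreeGroup ι)} (hc : ∀ i v, c i v ∈ K)
    (g : FreeGroup ι) (z : (FreeGroup ι ⧸ H) × FreeGroup ι) (hz : z.2 ∈ K) :
    (cocycleAction c g z).2 ∈ K := by
  induction g using FreeGroup.induction_on generalizing z with
  | C1 => simpa
  | of i => rw [cocycleAction_of]; exact K.mul_mem (hc _ _) hz
  | inv_of i _ => rw [cocycleAction_inv_of]; exact K.mul_mem (K.inv_mem (hc _ _)) hz
  | mul g h hg hh => rw [_root_.map_mul, Equiv.Perm.mul_apply]; exact hg _ (hh _ hz)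

/-- The label of the closed path at the base point of the Schreier graph given by `h ∈ H`. -/
def loopLabel : H →* FreeGroup ι where
  toFun h := (cocycleAction c h ((1 : FreeGroup ι), 1)).2
  map_one' := by simp
  map_mul' g h := by
    have hh : (h : FreeGroup ι) • ((1 : FreeGroup ι) : FreeGroup ι ⧸ H) = (1 : FreeGroup ι) := by
      rw [← QuotientGroup.mk_mul_of_mem 1 h.2]; simp
    have := cocycleAction_mul_right c g ((1 : FreeGroup ι) : FreeGroup ι ⧸ H) 1
      (cocycleAction c h ((1 : FreeGroup ι), 1)).2
    rw [one_mul] at this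
    rw [Subgroup.coe_mul, _root_.map_mul, Equiv.Perm.mul_apply,
      ← Prod.mk.eta (p := cocycleAction c h _), cocycleAction_fst, hh, this]

end SchreierCocycle

/-- A subgroup `H` containing `w` retracts onto one of finitely many subgroups that depend only on
`w` and still contain `w`. -/
theorem exists_retraction_onto_loopSubgroup {H : Subgroup (FreeGroup ι)} {w : FreeGroup ι}
    (hw : w ∈ H) :
    ∃ K ∈ loopSubgroups w, K ≤ H ∧ w ∈ K ∧
      ∃ r : H →* FreeGroup ι, (∀ h, r h ∈ K) ∧ ∀ h : H, (h : FreeGroup ι) ∈ K → r h = h := by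
  classical
  -- A section of `F → F ⧸ H` that chooses suffixes of `w` wherever possible.
  obtain ⟨t, ht, ht1, htS⟩ : ∃ t : FreeGroup ι ⧸ H → FreeGroup ι,
      (∀ v, (t v : FreeGroup ι ⧸ H) = v) ∧
      t (1 : FreeGroup ι) = 1 ∧ ∀ s ∈ suffixes w, t s ∈ suffixes w := by
    have h (v : FreeGroup ι ⧸ H) : ∃ x : FreeGroup ι, (x : FreeGroup ι ⧸ H) = v ∧
        (v = (1 : FreeGroup ι) → x = 1) ∧ ((∃ s ∈ suffixes w, (s : FreeGroup ι ⧸ H) = v) →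
          x ∈ suffixes w) := by
      by_cases h1 : v = (1 : FreeGroup ι)
      · exact ⟨1, h1.symm, fun _ => rfl, fun _ => one_mem_suffixes w⟩
      · by_cases h2 : ∃ s ∈ suffixes w, (s : FreeGroup ι ⧸ H) = v
        · obtain ⟨s, hs, hsv⟩ := h2
          exact ⟨s, hsv, fun h => absurd h h1, fun _ => hs⟩
        · exact ⟨v.out, QuotientGroup.out_eq' v, fun h => absurd h h1, fun h => absurd h h2⟩
    choose t h1 h2 h3 using h
    exact ⟨t, h1, h2 _ rfl, fun s hs => h3 _ ⟨s, hs, rfl⟩⟩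
  let V : Set (FreeGroup ι ⧸ H) := (fun s : FreeGroup ι => (s : FreeGroup ι ⧸ H)) '' suffixes w
  have htV : ∀ v ∈ V, t v ∈ suffixes w := by
    rintro _ ⟨s, hs, rfl⟩
    exact htS s hs
  -- Edges between visited vertices carry their Schreier generator, the others carry `1`.
  let c (i : ι) (v : FreeGroup ι ⧸ H) : FreeGroup ι :=
    if v ∈ V ∧ of i • v ∈ V then (t (of i • v))⁻¹ * of i * t v else 1
  have hcpos {i : ι} {v : FreeGroup ι ⧸ H} (h1 : v ∈ V) (h2 : of i • v ∈ V) :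
      c i v = (t (of i • v))⁻¹ * of i * t v := if_pos ⟨h1, h2⟩
  let K := Subgroup.closure {g | ∃ i v, g = c i v}
  have hcK (i v) : c i v ∈ K := Subgroup.subset_closure ⟨i, v, rfl⟩
  have hKH : K ≤ H := by
    rw [Subgroup.closure_le]
    rintro _ ⟨i, v, rfl⟩
    simp only [c]
    split_ifs
    · rw [SetLike.mem_coe, mul_assoc, ← QuotientGroup.eq, ht]
      conv_lhs => rw [← ht v]
      rfl
    · exact H.one_mem
  -- Hence the path `s` out of the base point, for a suffix `s`, carries the label `(t s)⁻¹ * s`.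
  have hpath : ∀ {s}, s ∈ suffixes w →
      cocycleAction c s ((1 : FreeGroup ι), 1) = ((s : FreeGroup ι ⧸ H), (t s)⁻¹ * s) := by
    intro s hs
    refine suffixes_induction ?_ ?_ ?_ hs
    · simp [ht1]
    · intro i s hs h ih
      rw [_root_.map_mul, Equiv.Perm.mul_apply, ih, cocycleAction_of,
        hcpos ⟨s, hs, rfl⟩ ⟨_, h, rfl⟩]
      refine Prod.ext rfl ?_
      change (t ↑(of i * s))⁻¹ * of i * t s * ((t s)⁻¹ * s) = _
      group
    · intro i s hs h ih
      have hi : of i • (((of i)⁻¹ * s : FreeGroup ι) : FreeGroup ι ⧸ H) = s := by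
        change ((of i * ((of i)⁻¹ * s) : FreeGroup ι) : FreeGroup ι ⧸ H) = s
        simp
      rw [_root_.map_mul, Equiv.Perm.mul_apply, ih, cocycleAction_inv_of]
      refine Prod.ext rfl ?_
      change (c i (((of i)⁻¹ * s : FreeGroup ι) : FreeGroup ι ⧸ H))⁻¹ * ((t s)⁻¹ * s) = _
      rw [hcpos ⟨_, h, rfl⟩ (hi ▸ ⟨s, hs, rfl⟩), hi]
      group
  -- The path to a visited vertex along its chosen representative has trivial label.
  have hpath' {v} (hv : v ∈ V) (x : FreeGroup ι) :
      cocycleAction c (t v) ((1 : FreeGroup ι), x) = (v, x) := by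
    have h1 := hpath (htV v hv)
    have h2 := cocycleAction_mul_right c (t v) ((1 : FreeGroup ι) : FreeGroup ι ⧸ H) 1 x
    rw [one_mul, h1, ht, inv_mul_cancel, one_mul] at h2
    rw [h2, ← cocycleAction_fst c (t v) ((1 : FreeGroup ι), (1 : FreeGroup ι)), h1, ht]
  have hlabel (h : H) (hs : (h : FreeGroup ι) ∈ suffixes w) : loopLabel c h = h := by
    change (cocycleAction c h ((1 : FreeGroup ι), 1)).2 = h
    have : ((h : FreeGroup ι) : FreeGroup ι ⧸ H) = (1 : FreeGroup ι) := by
      rw [eq_comm, QuotientGroup.eq]; simp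
    rw [hpath hs, this, ht1]
    simp
  have hmem (h : H) : loopLabel c h ∈ K := cocycleAction_snd_mem c hcK _ _ K.one_mem
  refine ⟨K, ⟨_, ?_, rfl⟩, hKH, ?_, loopLabel c, hmem, ?_⟩
  · rintro _ ⟨i, v, rfl⟩
    simp only [c]
    split_ifs with h
    · exact Or.inr ⟨_, htV _ h.2, _, htV _ h.1, i, rfl⟩
    · exact Or.inl rfl
  · have := hmem ⟨w, hw⟩
    rwa [hlabel ⟨w, hw⟩ (self_mem_suffixes w)] at this
  · rintro ⟨h, hH⟩ hK
    -- On `K` it suffices to treat a generator `c i v`: go to `v`, cross the edge, come back.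
    have hle : K ≤ ((loopLabel c).eqLocus H.subtype).map H.subtype := by
      rw [Subgroup.closure_le]
      rintro _ ⟨i, v, rfl⟩
      refine ⟨⟨c i v, hKH (hcK i v)⟩, ?_, rfl⟩
      change (cocycleAction c (c i v) ((1 : FreeGroup ι), 1)).2 = c i v
      by_cases hv : v ∈ V ∧ of i • v ∈ V
      · have hback : cocycleAction c (t (of i • v))⁻¹ (of i • v, c i v) =
            (((1 : FreeGroup ι) : FreeGroup ι ⧸ H), c i v) := by
          rw [_root_.map_inv, Equiv.Perm.inv_eq_iff_eq, hpath' hv.2]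
        conv_lhs => rw [hcpos hv.1 hv.2]
        rw [_root_.map_mul, Equiv.Perm.mul_apply, hpath' hv.1, _root_.map_mul, Equiv.Perm.mul_apply,
          cocycleAction_of, mul_one, hback]
      · have : c i v = 1 := if_neg hv
        simp [this]
    obtain ⟨g, hg, hgh⟩ := hle hK
    have : g = ⟨h, hH⟩ := Subtype.ext hgh
    subst this
    exact hg

/-- If `w` is fixed by an injective endomorphism `φ` that is not surjective, the retractions of the
subgroups `φⁿ(F)`, transported back to `F` by `φⁿ`, fix `w`; were they all injective, every `φⁿ(F)`
would equal its retract, so by finiteness the descending chain `φⁿ(F)` would be stationary. -/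
theorem exists_not_injective_of_not_bijective [Finite ι] {w : FreeGroup ι}
    (φ : FreeGroup ι →* FreeGroup ι) (hφw : φ w = w) (hφ : ¬ Function.Bijective φ) :
    ∃ ψ : FreeGroup ι →* FreeGroup ι, ψ w = w ∧ ¬ Function.Injective ψ := by
  by_contra! hall
  have hinj : Function.Injective φ := hall φ hφw
  let Φ (n : ℕ) : FreeGroup ι →* FreeGroup ι := HPow.hPow (α := Monoid.End (FreeGroup ι)) φ n
  have hΦ (n : ℕ) (x : FreeGroup ι) : Φ n x = φ^[n] x := by
    exact congrFun (Monoid.End.coe_pow (M := FreeGroup ι) φ n) x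
  have hΦinj (n : ℕ) : Function.Injective (Φ n) := fun x y h =>
    hinj.iterate n (by simpa only [hΦ] using h)
  have hΦw (n : ℕ) : Φ n w = w := by rw [hΦ]; exact Function.iterate_fixed hφw n
  have hmem (n : ℕ) : (Φ n).range ∈ loopSubgroups w := by
    obtain ⟨K, hK, hKH, hwK, r, hr, hrK⟩ :=
      exists_retraction_onto_loopSubgroup (H := (Φ n).range) ⟨w, hΦw n⟩
    let e : FreeGroup ι ≃* (Φ n).range := MonoidHom.ofInjective (hΦinj n)
    let r' : (Φ n).range →* (Φ n).range := r.codRestrict _ fun h => hKH (hr h)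
    have hew : e w = ⟨w, hKH hwK⟩ := Subtype.ext (hΦw n)
    have hψ := hall ((e.symm.toMonoidHom.comp r').comp e.toMonoidHom) <| by
      change e.symm (r' (e w)) = w
      rw [MulEquiv.symm_apply_eq, hew]
      exact Subtype.ext (hrK _ hwK)
    have hr' : Function.Injective r' := fun x y hxy => by
      apply e.symm.injective
      apply hψ
      change e.symm (r' (e (e.symm x))) = e.symm (r' (e (e.symm y)))
      simp [hxy]
    have hKeq : (Φ n).range = K := by
      refine le_antisymm (fun h hh => ?_) hKH
      have : r' ⟨h, hh⟩ = ⟨h, hh⟩ := hr' (Subtype.ext (hrK _ (hr _)))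
      have h2 : r ⟨h, hh⟩ = h := congrArg Subtype.val this
      exact h2 ▸ hr ⟨h, hh⟩
    rwa [hKeq]
  have := (finite_loopSubgroups w).to_subtype
  obtain ⟨n, m, hnm, heq⟩ := Finite.exists_ne_map_eq_of_infinite
    fun n => (⟨(Φ n).range, hmem n⟩ : loopSubgroups w)
  rw [Subtype.mk.injEq] at heq
  wlog hlt : n < m generalizing n m
  · exact this m n hnm.symm heq.symm (by omega)
  -- `φⁿ x = φᵐ y` with `n < m`; cancelling `φⁿ` exhibits a preimage of `x`.
  refine hφ ⟨hinj, fun x => ?_⟩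
  obtain ⟨y, hy⟩ : Φ n x ∈ (Φ m).range := heq ▸ ⟨x, rfl⟩
  obtain ⟨k, rfl⟩ := Nat.exists_eq_add_of_lt hlt
  refine ⟨φ^[k] y, ?_⟩
  rw [hΦ, hΦ, add_assoc, Function.iterate_add_apply] at hy
  rw [← Function.iterate_succ_apply' φ]
  exact hinj.iterate n hy

end FreeGroup

/-! ### Endomorphisms with cyclic image and exponent sums -/

theorem FreeGroupBasis.lift_apply_basis {ι F G : Type*} [Group F] [Group G]
    (A : FreeGroupBasis ι F) (f : ι → G) (i : ι) : A.lift f (A i) = f i :=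
  congrFun (A.lift.symm_apply_apply f) i

/-- A homomorphism with values in a cyclic subgroup is determined by the exponent sums. -/
theorem FreeGroupBasis.map_eq_zpow {ι F G : Type*} [Fintype ι] [DecidableEq ι] [Group F] [Group G]
    (A : FreeGroupBasis ι F) (φ : F →* G) (u : G) (x : ι → ℤ) (hφ : ∀ i, φ (A i) = u ^ x i)
    (w : F) : φ w = u ^ ∑ i, x i * exponentSum A i w := by
  let θ : Multiplicative (ι → ℤ) →* G :=
    (zpowersHom G u).comp (AddMonoidHom.toMultiplicative
      (∑ i, x i • Pi.evalAddMonoidHom (fun _ : ι => ℤ) i))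
  have hθ (z : Multiplicative (ι → ℤ)) : θ z = u ^ ∑ i, x i * z.toAdd i := by
    simp [θ, zpowersHom_apply, mul_comm]
  have h : φ = θ.comp (abelianizationMap A) := by
    apply A.ext_hom
    intro i
    have : abelianizationMap A (A i) = Multiplicative.ofAdd (Pi.single i (1 : ℤ)) :=
      A.lift_apply_basis _ i
    rw [hφ, MonoidHom.comp_apply, this, hθ]
    simp [Pi.single_apply]
  rw [h, MonoidHom.comp_apply, hθ]
  simp only [abelianizationMap_apply]

/-- A homomorphism sends the two basis elements to the transpositions `(0 1)` and `(1 2)` of three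
points, which do not commute. -/
theorem FreeGroupBasis.not_commute {F : Type*} [Group F] (A : FreeGroupBasis (Fin 2) F) :
    ¬ Commute (A 0) (A 1) := by
  intro h
  have h1 := h.map (A.lift ![Equiv.swap (0 : Fin 3) 1, Equiv.swap (1 : Fin 3) 2])
  simp only [FreeGroupBasis.lift_apply_basis] at h1
  revert h1
  simp only [Commute, SemiconjBy]
  decide

section RankTwo

variable {F : Type*} [Group F] (A : FreeGroupBasis (Fin 2) F) {w : F}

/-- If `x * w_a + y * w_b = 1`, the endomorphism `a ↦ w ^ x`, `b ↦ w ^ y` fixes `w`, and its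
image is commutative. -/
theorem not_isTestElement_of_isCoprime
    (h : IsCoprime (exponentSum A 0 w) (exponentSum A 1 w)) : ¬ IsTestElement w := by
  obtain ⟨x, y, hxy⟩ := h
  intro ht
  have hA (i : Fin 2) : A.lift (fun i => w ^ ![x, y] i) (A i) = w ^ ![x, y] i :=
    A.lift_apply_basis _ i
  have hfix : A.lift (fun i => w ^ ![x, y] i) w = w := by
    rw [A.map_eq_zpow _ w ![x, y] hA, Fin.sum_univ_two]
    simp [hxy]
  refine A.not_commute ((ht _ hfix).injective ?_)
  rw [map_mul, map_mul, hA, hA]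
  exact (Commute.refl w).zpow_zpow _ _

/-- If the image is generated by `u`, with `φ a = u ^ x` and `φ b = u ^ y`, then
`w = u ^ (x * w_a + y * w_b)`, and the exponent is `±1` since `w` is neither trivial nor a proper
power. -/
theorem isCoprime_of_isCyclic_range (hw : w ≠ 1) (hpow : ¬ IsProperPower w) (φ : F →* F)
    (hφw : φ w = w) (hφ : IsCyclic φ.range) :
    IsCoprime (exponentSum A 0 w) (exponentSum A 1 w) := by
  obtain ⟨⟨u, hu'⟩, hu⟩ := hφ
  have h (i : Fin 2) : ∃ x : ℤ, φ (A i) = u ^ x := by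
    obtain ⟨x, hx⟩ := hu ⟨φ (A i), A i, rfl⟩
    exact ⟨x, (congrArg Subtype.val hx).symm⟩
  choose x hx using h
  have hwm := A.map_eq_zpow φ u x hx w
  rw [hφw] at hwm
  obtain ⟨m, hm⟩ : ∃ m, m = ∑ i, x i * exponentSum A i w := ⟨_, rfl⟩
  rw [← hm] at hwm
  rw [Fin.sum_univ_two] at hm
  have hm1 : m.natAbs = 1 := by
    by_contra hne
    rcases Nat.lt_or_ge m.natAbs 2 with hlt | hge
    · have : m = 0 := by omega
      exact hw (by rw [hwm, this, zpow_zero])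
    · refine hpow ⟨m.natAbs, hge, ?_⟩
      rcases Int.natAbs_eq m with h | h
      · exact ⟨u, by rw [← zpow_natCast, ← h]; exact hwm⟩
      · exact ⟨u⁻¹, by rw [← zpow_natCast, inv_zpow', ← h]; exact hwm⟩
  have hmm : m * m = 1 := by
    rw [← Int.natAbs_mul_self' m, hm1]; rfl
  exact ⟨m * x 0, m * x 1, by rw [← hmm]; nth_rw 4 [hm]; ring⟩

theorem isTestElement_iff_not_isCoprime (hw : w ≠ 1) (hpow : ¬ IsProperPower w) :
    IsTestElement w ↔ ¬ IsCoprime (exponentSum A 0 w) (exponentSum A 1 w) := by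
  refine ⟨fun ht h => not_isTestElement_of_isCoprime A h ht, fun h => ?_⟩
  by_contra ht
  simp only [IsTestElement, not_forall] at ht
  obtain ⟨φ, hφw, hφ⟩ := ht
  -- Transported to `FreeGroup (Fin 2)` along `e`, `φ` yields a non-injective `ψ` that fixes `e w`.
  let e := A.repr
  obtain ⟨ψ, hψw, hψ⟩ := FreeGroup.exists_not_injective_of_not_bijective (w := e w)
    ((e.toMonoidHom.comp φ).comp e.symm.toMonoidHom) (by simp [hφw]) (fun hb => hφ <| by
      have : ⇑φ = e.symm ∘ ((e.toMonoidHom.comp φ).comp e.symm.toMonoidHom) ∘ e := by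
        ext g; simp
      rw [this]
      exact e.symm.bijective.comp (hb.comp e.bijective))
  have hψ' : (e.symm.toMonoidHom.comp ψ).comp e.toMonoidHom w = w := by simp [hψw]
  refine h (isCoprime_of_isCyclic_range A hw hpow _ hψ' ?_)
  have := A.isFreeGroup
  have hcyc := FreeGroup.isCyclic_range_of_not_injective (e.symm.toMonoidHom.comp ψ)
    fun hi => hψ fun x y hxy => hi (by simp [hxy])
  rwa [MonoidHom.range_comp, MonoidHom.range_eq_top.2 e.surjective, ← MonoidHom.range_eq_map]

/-! ### Coprimality of the exponent sums -/

theorem two_le_gcdTop_iff (x y : ℤ) : 2 ≤ gcdTop x y ↔ ¬ IsCoprime x y := by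
  rw [Int.isCoprime_iff_gcd_eq_one, gcdTop]
  split_ifs with h
  · simp [h.1, h.2]
  · have h0 : Int.gcd x y ≠ 0 := by rwa [Ne, Int.gcd_eq_zero_iff]
    rw [← Nat.cast_ofNat, Nat.cast_le]
    omega

theorem isVisibleElement_iff_isCoprime :
    IsVisibleElement A w ↔ IsCoprime (exponentSum A 0 w) (exponentSum A 1 w) := by
  have hgcd : Finset.univ.gcd (Multiplicative.toAdd (abelianizationMap A w)) =
      Int.gcd (exponentSum A 0 w) (exponentSum A 1 w) := by
    rw [show (Finset.univ : Finset (Fin 2)) = {0, 1} from rfl, Finset.gcd_insert,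
      Finset.gcd_singleton, abelianizationMap_apply, abelianizationMap_apply, Int.coe_gcd]
    exact (normalize_associated (exponentSum A 1 w)).gcd_eq_right (exponentSum A 0 w)
  rw [IsVisibleElement, IsVisiblePoint, hgcd, Int.isCoprime_iff_gcd_eq_one, Nat.cast_eq_one,
    and_iff_right_iff_imp]
  intro h h0
  rw [← abelianizationMap_apply, ← abelianizationMap_apply, h0] at h
  simp at h

theorem exists_isNthPower_iff_not_isCoprime :
    (∃ n : ℕ, 2 ≤ n ∧ IsNthPower n (abelianizationMap A w)) ↔
      ¬ IsCoprime (exponentSum A 0 w) (exponentSum A 1 w) := by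
  rw [← abelianizationMap_apply, ← abelianizationMap_apply]
  generalize abelianizationMap A w = v
  rw [Int.isCoprime_iff_gcd_eq_one]
  constructor
  · rintro ⟨n, hn, z, rfl⟩ h
    have h0 : (n : ℤ) ∣ Multiplicative.toAdd (z ^ n) 0 := by simp
    have h1 : (n : ℤ) ∣ Multiplicative.toAdd (z ^ n) 1 := by simp
    have := Int.dvd_coe_gcd h0 h1
    rw [h] at this
    have := Nat.le_of_dvd one_pos (Int.natCast_dvd_natCast.1 this)
    omega
  · intro h
    -- `n = 2` serves when the gcd is `0`, and `n` is the gcd otherwise.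
    obtain ⟨n, hn, h0, h1⟩ : ∃ n : ℕ, 2 ≤ n ∧ (n : ℤ) ∣ v.toAdd 0 ∧ (n : ℤ) ∣ v.toAdd 1 := by
      by_cases hz : Int.gcd (v.toAdd 0) (v.toAdd 1) = 0
      · rw [Int.gcd_eq_zero_iff] at hz
        exact ⟨2, le_rfl, by simp [hz.1], by simp [hz.2]⟩
      · exact ⟨_, by omega, Int.gcd_dvd_left .., Int.gcd_dvd_right ..⟩
    obtain ⟨x, hx⟩ := h0
    obtain ⟨y, hy⟩ := h1
    refine ⟨n, hn, Multiplicative.ofAdd ![x, y], ?_⟩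
    apply Multiplicative.toAdd.injective
    ext i
    fin_cases i <;> simp [hx, hy]

end RankTwo

theorem mainTheorem6 {F : Type*} [Group F] (A : FreeGroupBasis (Fin 2) F) (w : F)
    (hw : w ≠ 1) (hpow : ¬ IsProperPower w) :
    (IsTestElement w ↔ ∃ n : ℕ, 2 ≤ n ∧ IsNthPower n (abelianizationMap A w)) ∧
    (IsTestElement w ↔ 2 ≤ gcdTop (exponentSum A 0 w) (exponentSum A 1 w)) ∧
    (¬ IsTestElement w ↔ IsVisibleElement A w) := by
  rw [exists_isNthPower_iff_not_isCoprime, two_le_gcdTop_iff, isVisibleElement_iff_isCoprime,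
    isTestElement_iff_not_isCoprime A hw hpow, not_not]
  exact ⟨Iff.rfl, Iff.rfl, Iff.rfl⟩
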